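/- Let $0<s<1$, let $N>2s$, let $\Omega\subset\mathbb{R}^N$ be a bounded domain (a nonempty connected open set) with $C^\infty$ boundary, and put $\Omega^c=\mathbb{R}^N\setminus\Omega$. Let $f:\mathbb{R}\to\mathbb{R}$ be a continuous function such that (f1) $f(t)=0$ for $t<0$ and $f(t)>0$ for $t>0$; (f2) $\lim_{t\to0^+} f(t)/t=0$, and $\lim_{t\to\infty} f(t)/t^{p-1}=0$ for some $p$ with $2<p<\frac{2N}{N-2s}$; (f3) $\lim_{t\to\infty} f(t)/t=+\infty$. For $\varepsilon>0$ consider the fractional Neumann problem $$\varepsilon^{2s}(-\Delta)^s u+u=f(u)\ \text{ in }\Omega,\qquad \mathcal{N}_s u=0\ \text{ in }\mathbb{R}^N\setminus\Omega,$$ where $\mathcal{N}_s u(x)=C_{N,s}\int_\Omega\frac{u(x)-u(y)}{|x-y|^{N+2s}}\,dy$ and $C_{N,s}=\frac{4^s s\,\Gamma(N/2+s)}{\pi^{N/2}\,\Gamma(1-s)}$ is the normalization constant of the fractional Laplacian. Let $$\langle u,v\rangle_{\varepsilon,s}=\frac{C_{N,s}\,\varepsilon^{2s}}{2}\iint_{\mathbb{R}^{2N}\setminus(\Omega^c)^2}\frac{(u(x)-u(y))(v(x)-v(y))}{|x-y|^{N+2s}}\,dx\,dy+\int_\Omega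 uv\,dx,$$ and let $H^s_\varepsilon(\Omega)$ be the space of measurable $u:\mathbb{R}^N\to\mathbb{R}$ with $\langle u,u\rangle_{\varepsilon,s}<\infty$. A solution of the problem is a function $u\in H^s_\varepsilon(\Omega)$ such that $\langle u,v\rangle_{\varepsilon,s}-\int_\Omega f(u)\,v\,dx=0$ for all $v\in H^s_\varepsilon(\Omega)$. Then there is $\varepsilon_0>0$, depending only on $N$, $s$, $\Omega$ and $f$, such that for every $0<\varepsilon<\varepsilon_0$ every solution $u_\varepsilon$ of the problem belongs to $L^\infty(\Omega)$. -/

import Mathlib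

open MeasureTheory Filter Topology
open scoped ENNReal ContDiff

noncomputable section

namespace FracNeumann

/-- A smooth bounded domain of `ℝ^N`: a bounded, nonempty, connected open set such that near every
boundary point it is the sublevel set `{ρ < 0}` of a `C^∞` function `ρ` whose differential does not
vanish at that point. -/
structure IsSmoothBoundedDomain {N : ℕ} (Ω : Set (EuclideanSpace ℝ (Fin N))) : Prop where
  isOpen : IsOpen Ω
  isConnected : IsConnected Ω
  isBounded : Bornology.IsBounded Ω
  smooth_boundary : ∀ x ∈ frontier Ω,
    ∃ (U : Set (EuclideanSpace ℝ (Fin N))) (ρ : EuclideanSpace ℝ (Fin N) → ℝ),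
      IsOpen U ∧ x ∈ U ∧ ContDiffOn ℝ ∞ ρ U ∧ fderiv ℝ ρ x ≠ 0 ∧
        Ω ∩ U = {y ∈ U | ρ y < 0}

/-- The normalization constant of the fractional Laplacian `(-Δ)^s` on `ℝ^N`, `0 < s < 1`:
`C_{N,s} = 4^s s Γ(N/2 + s) / (π^{N/2} Γ(1 - s))`. -/
def normConst (N : ℕ) (s : ℝ) : ℝ :=
  (4 : ℝ) ^ s * s * Real.Gamma ((N : ℝ) / 2 + s) /
    (Real.pi ^ ((N : ℝ) / 2) * Real.Gamma (1 - s))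

/-- The region of interaction `ℝ^{2N} \ (Ω^c)²`. -/
def interactionSet {N : ℕ} (Ω : Set (EuclideanSpace ℝ (Fin N))) :
    Set (EuclideanSpace ℝ (Fin N) × EuclideanSpace ℝ (Fin N)) :=
  (Ωᶜ ×ˢ Ωᶜ)ᶜ

/-- The integrand `(u(x) - u(y)) (v(x) - v(y)) / |x - y|^{N + 2s}`. -/
def gagliardoIntegrand {N : ℕ} (s : ℝ) (u v : EuclideanSpace ℝ (Fin N) → ℝ)
    (z : EuclideanSpace ℝ (Fin N) × EuclideanSpace ℝ (Fin N)) : ℝ :=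
  (u z.1 - u z.2) * (v z.1 - v z.2) / ‖z.1 - z.2‖ ^ ((N : ℝ) + 2 * s)

/-- `⟨u, u⟩_{ε,s}` as an element of `[0, ∞]`:
`(C_{N,s} ε^{2s} / 2) ∬_{ℝ^{2N} \ (Ω^c)²} |u(x) - u(y)|² / |x - y|^{N + 2s} dx dy + ∫_Ω u² dx`. -/
def energyNormSq {N : ℕ} (s ε : ℝ) (Ω : Set (EuclideanSpace ℝ (Fin N)))
    (u : EuclideanSpace ℝ (Fin N) → ℝ) : ℝ≥0∞ :=
  ENNReal.ofReal (normConst N s * ε ^ (2 * s) / 2) *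
      (∫⁻ z in interactionSet Ω, ENNReal.ofReal (gagliardoIntegrand s u u z)) +
    ∫⁻ x in Ω, ENNReal.ofReal (u x ^ 2)

/-- Membership in `H^s_ε(Ω)`: (Lebesgue) measurable `u : ℝ^N → ℝ` with `⟨u, u⟩_{ε,s} < ∞`. -/
structure MemHs {N : ℕ} (s ε : ℝ) (Ω : Set (EuclideanSpace ℝ (Fin N)))
    (u : EuclideanSpace ℝ (Fin N) → ℝ) : Prop where
  aemeasurable : AEMeasurable u
  energy_lt_top : energyNormSq s ε Ω u < ⊤

/-- The bilinear form `⟨u, v⟩_{ε,s}`. -/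
def energyForm {N : ℕ} (s ε : ℝ) (Ω : Set (EuclideanSpace ℝ (Fin N)))
    (u v : EuclideanSpace ℝ (Fin N) → ℝ) : ℝ :=
  normConst N s * ε ^ (2 * s) / 2 * (∫ z in interactionSet Ω, gagliardoIntegrand s u v z) +
    ∫ x in Ω, u x * v x

/-- `u` is a (weak) solution of `ε^{2s} (-Δ)^s u + u = f(u)` in `Ω`, `𝒩_s u = 0` in `ℝ^N \ Ω`. -/
structure IsWeakSolution {N : ℕ} (s ε : ℝ) (Ω : Set (EuclideanSpace ℝ (Fin N))) (f : ℝ → ℝ)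
    (u : EuclideanSpace ℝ (Fin N) → ℝ) : Prop where
  memHs : MemHs s ε Ω u
  weak_eq : ∀ v : EuclideanSpace ℝ (Fin N) → ℝ, MemHs s ε Ω v →
    energyForm s ε Ω u v - ∫ x in Ω, f (u x) * v x = 0

end FracNeumann

end

/-! The bound comes from De Giorgi iteration on truncations of `u`, powered by a critical Sobolev
inequality on `Ω`.

Sobolev inequality. A smooth bounded domain fills a fixed fraction of every small ball centred in it
(`exists_measureDensity`). If `w x = t` is large, Chebyshev makes `{w ≥ t / 2}` so small that a ball
about `x`, of radius fitted to that measure, contains many points of `Ω` where `w < t / 2`. These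
points alone bound the Gagliardo integral in the slice at `x` from below (`rpow_critExp_le_slice`).
Integrating in `x` and absorbing a power of `∫ w ^ q`, with `q = 2N / (N - 2s)`, gives
`lintegral_rpow_critExp_le`.

Iteration. Testing the equation with `(u - k)₊` bounds the energy of this truncation by `∫ f(u) (u -
k)₊`. Along the levels `K (1 - 2⁻ʲ)`, the growth `f t ≤ t ^ (p - 1)` and the Sobolev inequality give
a recursion for `Y j = ∫ (u - k_j)₊ ^ q`: `Y (j + 1) ^ (2 / q)` is at most `D K ^ (p - q) B ^ j Y
j`. As `2 / q < 1` and `p < q`, a large `K` forces `Y j → 0`, hence `u ≤ K`. Testing with `min u 0`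
gives `u ≥ 0`. Constants may depend on `ε` and `u`, so no smallness of `ε` enters. -/

namespace FracNeumann

/-! ### Measure density of smooth domains -/

/-- A measure density condition: every ball of radius at most `r₀` centred in `Ω` meets `Ω` in
measure at least `c r ^ N`. -/
def MeasureDensity {N : ℕ} (Ω : Set (EuclideanSpace ℝ (Fin N))) (c r₀ : ℝ) : Prop :=
  ∀ x ∈ Ω, ∀ r : ℝ, 0 < r → r ≤ r₀ → ENNReal.ofReal (c * r ^ N) ≤ volume (Metric.ball x r ∩ Ω)

/-- Near `x₀`, every small ball centred in `Ω` contains a proportional ball inside `Ω`. -/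
def CorkscrewAt {N : ℕ} (Ω : Set (EuclideanSpace ℝ (Fin N))) (x₀ : EuclideanSpace ℝ (Fin N)) :
    Prop :=
  ∃ δ > 0, ∃ κ > 0, ∀ x ∈ Ω ∩ Metric.ball x₀ δ, ∀ r : ℝ, 0 < r → r ≤ δ →
    ∃ y, Metric.ball y (κ * r) ⊆ Metric.ball x r ∩ Ω

theorem corkscrewAt_of_mem {N : ℕ} {Ω : Set (EuclideanSpace ℝ (Fin N))} (hΩ : IsOpen Ω)
    {x₀ : EuclideanSpace ℝ (Fin N)} (hx : x₀ ∈ Ω) : CorkscrewAt Ω x₀ := by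
  obtain ⟨δ, hδ, hb⟩ := Metric.isOpen_iff.1 hΩ x₀ hx
  refine ⟨δ / 2, by positivity, 1, one_pos, fun x hxx r hr hrδ => ⟨x, ?_⟩⟩
  rw [one_mul]
  refine fun y hy => ⟨hy, hb ?_⟩
  have h1 := hxx.2
  rw [Metric.mem_ball] at hy h1 ⊢
  linarith [dist_triangle y x x₀]

/-- Moving from `x` along a direction `e` in which `ρ` decreases to first order keeps `ρ` negative,
and so does any direction close to `e`. -/
theorem corkscrewAt_of_mem_frontier {N : ℕ} {Ω : Set (EuclideanSpace ℝ (Fin N))}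
    (hΩ : IsSmoothBoundedDomain Ω) {x₀ : EuclideanSpace ℝ (Fin N)} (hx : x₀ ∈ frontier Ω) :
    CorkscrewAt Ω x₀ := by
  obtain ⟨U, ρ, hU, hxU, hρ, hd, hΩU⟩ := hΩ.smooth_boundary x₀ hx
  -- Strict differentiability is needed because increments are taken from any `x` near `x₀`, not
  -- from `x₀` itself.
  have hsd : HasStrictFDerivAt ρ (fderiv ℝ ρ x₀) x₀ :=
    (hρ.contDiffAt (hU.mem_nhds hxU)).hasStrictFDerivAt (by simp)
  set L := fderiv ℝ ρ x₀ with hL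
  obtain ⟨e, he⟩ : ∃ e, L e < 0 := by
    obtain ⟨e, he⟩ : ∃ e, L e ≠ 0 := by
      by_contra! h
      exact hd (ContinuousLinearMap.ext h)
    rcases lt_or_gt_of_ne he with h | h
    · exact ⟨e, h⟩
    · exact ⟨-e, by simpa using h⟩
  have hepos : 0 < ‖e‖ := norm_pos_iff.2 (by rintro rfl; simp at he)
  -- `a` is the loss allowed per unit of length
  set a : ℝ := -L e / (4 * ‖e‖) with ha
  have ha0 : 0 < a := div_pos (by linarith) (by positivity)
  have hae : a * (2 * ‖e‖) = -L e / 2 := by rw [ha]; field_simp; ring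
  have hlo := hsd.isLittleO.def ha0
  obtain ⟨δ, hδ, hball⟩ := Metric.eventually_nhds_iff_ball.1
    (hlo.and ((hU.mem_nhds hxU |> fun h => (continuous_fst.tendsto (x₀, x₀)).eventually h)))
  -- `b` is the admissible perturbation of the direction `e`
  set b : ℝ := min ‖e‖ (-L e / (4 * (‖L‖ + 1))) with hb
  have hL1 : 0 < ‖L‖ + 1 := by positivity
  have hb0 : 0 < b := lt_min hepos (div_pos (by linarith) (by positivity))
  have hbL : ‖L‖ * b ≤ -L e / 4 := by
    have h1 : b ≤ -L e / (4 * (‖L‖ + 1)) := min_le_right _ _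
    rw [le_div_iff₀ (by positivity)] at h1
    nlinarith
  refine ⟨δ / 2, by positivity, b / (2 * ‖e‖), by positivity, fun x hxx r hr hrδ => ?_⟩
  set t : ℝ := r / (2 * ‖e‖) with ht
  have ht0 : 0 < t := by positivity
  have htr : t * (2 * ‖e‖) = r := by rw [ht]; field_simp
  have hbt : b / (2 * ‖e‖) * r = b * t := by rw [ht]; ring
  refine ⟨x + t • e, fun y hy => ?_⟩
  rw [hbt, Metric.mem_ball, dist_eq_norm] at hy
  set z := y - (x + t • e) with hz
  have hyx : y - x = t • e + z := by rw [hz]; abel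
  have hbe : b ≤ ‖e‖ := min_le_left _ _
  have hn : ‖y - x‖ < t * (2 * ‖e‖) := by
    rw [hyx]
    calc ‖t • e + z‖ ≤ ‖t • e‖ + ‖z‖ := norm_add_le _ _
      _ < t * ‖e‖ + b * t := by rw [norm_smul, Real.norm_of_nonneg ht0.le]; linarith
      _ ≤ _ := by nlinarith
  have hyr : y ∈ Metric.ball x r := by rw [Metric.mem_ball, dist_eq_norm]; linarith
  refine ⟨hyr, ?_⟩
  have hx1 := hxx.2
  rw [Metric.mem_ball] at hyr hx1
  have hy1 : dist y x₀ < δ := by linarith [dist_triangle y x x₀]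
  have hmem : (y, x) ∈ Metric.ball (x₀, x₀) δ := by
    rw [Metric.mem_ball, Prod.dist_eq]; exact max_lt hy1 (by linarith)
  obtain ⟨h1, hyU⟩ := hball _ hmem
  have hmem' : (x, x) ∈ Metric.ball (x₀, x₀) δ := by
    rw [Metric.mem_ball, Prod.dist_eq]; exact max_lt (by linarith) (by linarith)
  have hxU' : x ∈ U := (hball _ hmem').2
  have hxneg : ρ x < 0 := ((Set.ext_iff.1 hΩU x).1 ⟨hxx.1, hxU'⟩).2
  have hLz : L (y - x) ≤ t * L e + ‖L‖ * (b * t) := by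
    rw [hyx, map_add, map_smul, smul_eq_mul]
    have := (le_abs_self _).trans (L.le_opNorm z)
    have : ‖L‖ * ‖z‖ ≤ ‖L‖ * (b * t) := by gcongr
    linarith
  have h2 : ρ y - ρ x - L (y - x) ≤ a * ‖y - x‖ := (le_abs_self _).trans h1
  have h3 : a * ‖y - x‖ ≤ a * (t * (2 * ‖e‖)) := by gcongr
  -- The perturbation costs at most a quarter of `-t * L e` and the remainder at most half, so `ρ y
  -- - ρ x ≤ t * L e / 4 < 0`.
  have hyneg : ρ y < 0 := by nlinarith
  exact ((Set.ext_iff.1 hΩU y).2 ⟨hyU, hyneg⟩).1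

theorem IsSmoothBoundedDomain.corkscrewAt {N : ℕ} {Ω : Set (EuclideanSpace ℝ (Fin N))}
    (hΩ : IsSmoothBoundedDomain Ω) {x₀ : EuclideanSpace ℝ (Fin N)} (hx : x₀ ∈ closure Ω) :
    CorkscrewAt Ω x₀ := by
  by_cases h : x₀ ∈ Ω
  · exact corkscrewAt_of_mem hΩ.isOpen h
  · exact corkscrewAt_of_mem_frontier hΩ (by rw [hΩ.isOpen.frontier_eq]; exact ⟨hx, h⟩)

theorem IsSmoothBoundedDomain.exists_measureDensity {N : ℕ}
    {Ω : Set (EuclideanSpace ℝ (Fin N))} (hΩ : IsSmoothBoundedDomain Ω) :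
    ∃ c > 0, ∃ r₀ > 0, MeasureDensity Ω c r₀ := by
  have hcpt : IsCompact (closure Ω) := hΩ.isBounded.isCompact_closure
  have key : ∃ κ > 0, ∃ r₀ > 0, ∀ x ∈ Ω ∩ closure Ω, ∀ r : ℝ, 0 < r → r ≤ r₀ →
      ∃ y, Metric.ball y (κ * r) ⊆ Metric.ball x r ∩ Ω := by
    refine hcpt.induction_on (p := fun K => ∃ κ > 0, ∃ r₀ > 0, ∀ x ∈ Ω ∩ K, ∀ r : ℝ, 0 < r →
      r ≤ r₀ → ∃ y, Metric.ball y (κ * r) ⊆ Metric.ball x r ∩ Ω) ?_ ?_ ?_ ?_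
    · exact ⟨1, one_pos, 1, one_pos, by simp⟩
    · rintro K K' hK ⟨κ, hκ, r₀, hr₀, h⟩
      exact ⟨κ, hκ, r₀, hr₀, fun x hx => h x ⟨hx.1, hK hx.2⟩⟩
    · rintro K K' ⟨κ, hκ, r₀, hr₀, h⟩ ⟨κ', hκ', r₀', hr₀', h'⟩
      refine ⟨min κ κ', lt_min hκ hκ', min r₀ r₀', lt_min hr₀ hr₀', ?_⟩
      rintro x ⟨hx, hxK | hxK⟩ r hr hr'
      · obtain ⟨y, hy⟩ := h x ⟨hx, hxK⟩ r hr (hr'.trans (min_le_left _ _))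
        exact ⟨y, (Metric.ball_subset_ball (by gcongr; exact min_le_left _ _)).trans hy⟩
      · obtain ⟨y, hy⟩ := h' x ⟨hx, hxK⟩ r hr (hr'.trans (min_le_right _ _))
        exact ⟨y, (Metric.ball_subset_ball (by gcongr; exact min_le_right _ _)).trans hy⟩
    · intro x₀ hx₀
      obtain ⟨δ, hδ, κ, hκ, h⟩ := hΩ.corkscrewAt hx₀
      exact ⟨Metric.ball x₀ δ, mem_nhdsWithin_of_mem_nhds (Metric.ball_mem_nhds _ hδ),
        κ, hκ, δ, hδ, h⟩
  obtain ⟨κ, hκ, r₀, hr₀, h⟩ := key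
  set m := volume (Metric.ball (0 : EuclideanSpace ℝ (Fin N)) 1) with hm
  have hmpos : 0 < m := Metric.measure_ball_pos _ _ one_pos
  have hmtop : m ≠ ⊤ := measure_ball_lt_top.ne
  refine ⟨κ ^ N * m.toReal, by have := ENNReal.toReal_pos hmpos.ne' hmtop; positivity,
    r₀, hr₀, fun x hx r hr hrr => ?_⟩
  obtain ⟨y, hy⟩ := h x ⟨hx, subset_closure hx⟩ r hr hrr
  refine le_trans (le_of_eq ?_) (measure_mono hy)
  rw [Measure.addHaar_ball_of_pos volume y (by positivity), finrank_euclideanSpace_fin,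
    show κ ^ N * m.toReal * r ^ N = (κ * r) ^ N * m.toReal by ring,
    ENNReal.ofReal_mul (by positivity), ENNReal.ofReal_toReal hmtop]

/-! ### The critical fractional Sobolev inequality -/

theorem aemeasurable_gagliardoIntegrand {N : ℕ} (s : ℝ) {u v : EuclideanSpace ℝ (Fin N) → ℝ}
    {μ : Measure (EuclideanSpace ℝ (Fin N))} [SFinite μ]
    (hu : AEMeasurable u μ) (hv : AEMeasurable v μ) :
    AEMeasurable (gagliardoIntegrand s u v) (μ.prod μ) := by
  unfold gagliardoIntegrand
  refine (((hu.comp_fst).sub (hu.comp_snd)).mul ((hv.comp_fst).sub (hv.comp_snd))).div ?_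
  exact ((measurable_fst.sub measurable_snd).norm.pow_const _).aemeasurable

theorem gagliardoIntegrand_self_nonneg {N : ℕ} (s : ℝ) (u : EuclideanSpace ℝ (Fin N) → ℝ)
    (z : EuclideanSpace ℝ (Fin N) × EuclideanSpace ℝ (Fin N)) :
    0 ≤ gagliardoIntegrand s u u z :=
  div_nonneg (mul_self_nonneg _) (by positivity)

/-- The critical Sobolev exponent `2N / (N - 2s)`. -/
noncomputable def critExp (N : ℕ) (s : ℝ) : ℝ := 2 * (N : ℝ) / ((N : ℝ) - 2 * s)

theorem two_lt_critExp {N : ℕ} {s : ℝ} (hs : 0 < s) (hN : 2 * s < N) : 2 < critExp N s := by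
  rw [critExp, lt_div_iff₀ (by linarith)]; linarith

theorem critExp_mul {N : ℕ} {s : ℝ} (hs : 0 < s) (hN : 2 * s < N) :
    critExp N s * (2 * s / N) = critExp N s - 2 := by
  have : (0 : ℝ) < N := by linarith
  have : (N : ℝ) - 2 * s ≠ 0 := by linarith
  rw [critExp]; field_simp; ring

theorem one_sub_eq_two_div_critExp {N : ℕ} {s : ℝ} (hs : 0 < s) (hN : 2 * s < N) :
    1 - 2 * s / N = 2 / critExp N s := by
  have : (0 : ℝ) < N := by linarith
  have : (N : ℝ) - 2 * s ≠ 0 := by linarith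
  rw [critExp]; field_simp

/-- The constant in the pointwise estimate `rpow_critExp_le_slice`. -/
noncomputable def sliceConst (N : ℕ) (s c : ℝ) : ℝ :=
  8 / c * (2 * 2 ^ critExp N s / c) ^ (2 * s / N)

theorem measure_half_le_of_lintegral_le {α : Type*} [MeasurableSpace α] {μ : Measure α}
    {w : α → ℝ} (hw : AEMeasurable w μ) {a t S : ℝ} (ha : 0 < a) (ht : 0 < t)
    (hS : ∫⁻ y, ENNReal.ofReal (w y ^ a) ∂μ ≤ ENNReal.ofReal S) :
    μ {y | t / 2 ≤ w y} ≤ ENNReal.ofReal (S * (2 / t) ^ a) := by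
  have h1 := mul_meas_ge_le_lintegral₀ ((hw.pow_const a).ennreal_ofReal)
    (ENNReal.ofReal ((t / 2) ^ a))
  have h2 : μ {y | t / 2 ≤ w y} ≤
      μ {y | ENNReal.ofReal ((t / 2) ^ a) ≤ ENNReal.ofReal (w y ^ a)} :=
    measure_mono fun y (hy : t / 2 ≤ w y) =>
      ENNReal.ofReal_le_ofReal (Real.rpow_le_rpow (by positivity) hy ha.le)
  have hpos : (0 : ℝ) < (t / 2) ^ a := by positivity
  have h3 : S * (2 / t) ^ a = S / (t / 2) ^ a := by
    rw [div_eq_mul_inv S, ← Real.inv_rpow (by positivity), inv_div]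
  rw [h3, ENNReal.ofReal_div_of_pos hpos, ENNReal.le_div_iff_mul_le
    (Or.inl (by simpa using hpos)) (Or.inl ENNReal.ofReal_ne_top), mul_comm]
  exact (mul_le_mul_right h2 _).trans (h1.trans hS)

theorem rpow_critExp_le_slice {N : ℕ} {s : ℝ} (hs : 0 < s) (hN : 2 * s < N)
    {Ω : Set (EuclideanSpace ℝ (Fin N))} {c r₀ : ℝ} (hc : 0 < c) (hr₀ : 0 < r₀)
    (hΩ : MeasureDensity Ω c r₀) {w : EuclideanSpace ℝ (Fin N) → ℝ}
    (hw : AEMeasurable w (volume.restrict Ω)) {S S₂ : ℝ} (hSpos : 0 < S) (hS₂pos : 0 < S₂)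
    (hS : ∫⁻ y in Ω, ENNReal.ofReal (w y ^ critExp N s) ≤ ENNReal.ofReal S)
    (hS₂ : ∫⁻ y in Ω, ENNReal.ofReal (w y ^ (2 : ℝ)) ≤ ENNReal.ofReal S₂)
    {x : EuclideanSpace ℝ (Fin N)} (hx : x ∈ Ω) (hwx : 0 < w x)
    (hlarge : 8 * S₂ ≤ c * r₀ ^ N * w x ^ 2) :
    ENNReal.ofReal (w x ^ critExp N s) ≤
      ENNReal.ofReal (sliceConst N s c * S ^ (2 * s / N)) *
        ∫⁻ y in Ω, ENNReal.ofReal (gagliardoIntegrand s w w (x, y)) := by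
  set q := critExp N s with hq
  have hq2 : 2 < q := two_lt_critExp hs hN
  have hNpos : (0 : ℝ) < N := by linarith
  have hN0 : N ≠ 0 := by rintro rfl; simp at hNpos
  set t := w x with ht
  -- Both entries bound the measure of `{w ≥ t / 2}` by Chebyshev. The first carries the critical
  -- scaling; the second, with `hlarge`, keeps the radius below `r₀`.
  set M : ℝ := min (S * (2 / t) ^ q) (S₂ * (2 / t) ^ (2 : ℝ)) with hM
  have hMpos : 0 < M := lt_min (by positivity) (by positivity)
  -- This radius gives the ball measure at least `2 * M` in `Ω`, so at least `M` remains after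
  -- removing `A`.
  set r : ℝ := (2 * M / c) ^ (1 / (N : ℝ)) with hr
  have hrpos : 0 < r := by positivity
  have hrN' : r ^ (N : ℝ) = 2 * M / c := by
    rw [hr, ← Real.rpow_mul (by positivity), one_div, inv_mul_cancel₀ hNpos.ne', Real.rpow_one]
  have hrN : c * r ^ N = 2 * M := by
    rw [← Real.rpow_natCast, hrN']; field_simp
  have hrr₀ : r ≤ r₀ := by
    refine le_of_pow_le_pow_left₀ hN0 hr₀.le ?_
    refine le_of_mul_le_mul_left ?_ hc
    rw [hrN]
    have h1 : M ≤ S₂ * (2 / t) ^ (2 : ℝ) := min_le_right _ _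
    have h2 : S₂ * (2 / t) ^ (2 : ℝ) * t ^ 2 = 4 * S₂ := by
      rw [Real.rpow_two]; field_simp; ring
    have h3 : 0 < t ^ 2 := by positivity
    refine le_of_mul_le_mul_right (a := t ^ 2) ?_ h3
    nlinarith
  set μ := volume.restrict Ω with hμ
  set A := {y | t / 2 ≤ w y} with hA
  have hμA : μ A ≤ ENNReal.ofReal M := by
    rw [hM, ENNReal.ofReal_min]
    exact le_min (measure_half_le_of_lintegral_le hw (by linarith) hwx hS)
      (measure_half_le_of_lintegral_le hw two_pos hwx hS₂)
  have hball : ENNReal.ofReal M + ENNReal.ofReal M ≤ μ (Metric.ball x r) := by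
    rw [hμ, Measure.restrict_apply measurableSet_ball, ← ENNReal.ofReal_add hMpos.le hMpos.le,
      ← two_mul, ← hrN]
    exact hΩ x hx r hrpos hrr₀
  have hB : ENNReal.ofReal M ≤ μ (Metric.ball x r \ A) := by
    have h1 : μ (Metric.ball x r) ≤ μ (Metric.ball x r \ A) + μ A :=
      (measure_mono (by intro y hy; by_cases h : y ∈ A <;> simp [h, hy])).trans
        (measure_union_le _ _)
    have h2 := hball.trans (h1.trans (add_le_add_right hμA _))
    exact (ENNReal.add_le_add_iff_right ENNReal.ofReal_ne_top).1 h2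
  set k : ℝ := (t / 2) ^ 2 / r ^ ((N : ℝ) + 2 * s) with hk
  have hk0 : 0 ≤ k := by positivity
  have hmeas : AEMeasurable (fun y => ENNReal.ofReal (gagliardoIntegrand s w w (x, y))) μ := by
    refine AEMeasurable.ennreal_ofReal ?_
    have h1 : AEMeasurable (fun y => w x - w y) μ := hw.const_sub _
    have h2 : Measurable fun y => ‖x - y‖ ^ ((N : ℝ) + 2 * s) :=
      (measurable_const.sub measurable_id).norm.pow_const _
    exact (h1.mul h1).div h2.aemeasurable
  have hsub : Metric.ball x r \ A ⊆
      {y | ENNReal.ofReal k ≤ ENNReal.ofReal (gagliardoIntegrand s w w (x, y))} := by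
    rintro y ⟨hy, hyA⟩
    have hyA : w y < t / 2 := not_le.1 hyA
    refine ENNReal.ofReal_le_ofReal ?_
    have hxy : 0 < ‖x - y‖ := by
      rw [norm_pos_iff, sub_ne_zero]
      rintro rfl
      linarith
    have hxr : ‖x - y‖ ≤ r := by rw [← dist_eq_norm, dist_comm]; exact (Metric.mem_ball.1 hy).le
    unfold gagliardoIntegrand
    have hpow : ‖x - y‖ ^ ((N : ℝ) + 2 * s) ≤ r ^ ((N : ℝ) + 2 * s) :=
      Real.rpow_le_rpow hxy.le hxr (by positivity)
    refine div_le_div₀ (mul_self_nonneg _) ?_ (by positivity) hpow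
    nlinarith
  have hG := (mul_le_mul_right (hB.trans (measure_mono hsub)) (ENNReal.ofReal k)).trans
    (mul_meas_ge_le_lintegral₀ hmeas (ENNReal.ofReal k))
  rw [← ENNReal.ofReal_mul hk0] at hG
  have hC0 : 0 ≤ sliceConst N s c * S ^ (2 * s / N) := by unfold sliceConst; positivity
  refine le_trans ?_ (mul_le_mul_right hG _)
  rw [← ENNReal.ofReal_mul hC0]
  refine ENNReal.ofReal_le_ofReal ?_
  -- the remaining inequality between real numbers
  set R : ℝ := (2 * M / c) ^ (2 * s / N) with hR
  have hRpos : 0 < R := by positivity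
  have hr2 : r ^ (2 * s) = R := by
    rw [hr, hR, ← Real.rpow_mul (by positivity)]; congr 1; ring
  have hkM : k * M = t ^ 2 * c / (8 * R) := by
    rw [hk, Real.rpow_add hrpos, hrN', hr2]; field_simp; ring
  have htq : t ^ q = t ^ 2 * (t ^ q) ^ (2 * s / N) := by
    rw [← Real.rpow_mul hwx.le, critExp_mul hs hN, ← Real.rpow_two, ← Real.rpow_add hwx]
    congr 1; ring
  -- The power `2s / N` turns `t ^ q` into `t ^ (q - 2)`, and `t ^ q * M ≤ 2 ^ q * S` cancels the
  -- dependence on `t`.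
  have hmain : (t ^ q) ^ (2 * s / N) * R ≤ (2 * 2 ^ q / c) ^ (2 * s / N) * S ^ (2 * s / N) := by
    rw [hR, ← Real.mul_rpow (by positivity) (by positivity),
      ← Real.mul_rpow (by positivity) hSpos.le]
    refine Real.rpow_le_rpow (by positivity) ?_ (by positivity)
    have h1 : M ≤ S * (2 / t) ^ q := min_le_left _ _
    have h2 : t ^ q * (2 / t) ^ q = 2 ^ q := by
      rw [← Real.mul_rpow hwx.le (by positivity)]; congr 1; field_simp
    calc t ^ q * (2 * M / c) ≤ t ^ q * (2 * (S * (2 / t) ^ q) / c) := by gcongr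
      _ = 2 * (t ^ q * (2 / t) ^ q) / c * S := by ring
      _ = _ := by rw [h2]
  rw [htq, hkM, sliceConst, ← hq]
  calc t ^ 2 * (t ^ q) ^ (2 * s / N) = t ^ 2 * ((t ^ q) ^ (2 * s / N) * R) / R := by field_simp
    _ ≤ t ^ 2 * ((2 * 2 ^ q / c) ^ (2 * s / N) * S ^ (2 * s / N)) / R := by gcongr
    _ = _ := by field_simp

/-- The constant in the fractional Sobolev inequality `lintegral_rpow_critExp_le`. -/
noncomputable def sobolevConst (N : ℕ) (s c r₀ V : ℝ) : ℝ :=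
  (2 * V) ^ (2 / critExp N s) * (8 / (c * r₀ ^ N)) + 2 * sliceConst N s c

/-- Boundedness makes `∫ w ^ q` finite in advance, which allows its power to be absorbed. Monotone
convergence removes it later. -/
theorem lintegral_rpow_critExp_le_of_bounded {N : ℕ} {s : ℝ} (hs : 0 < s) (hN : 2 * s < N)
    {Ω : Set (EuclideanSpace ℝ (Fin N))} (hΩm : MeasurableSet Ω) (hΩfin : volume Ω ≠ ⊤)
    {c r₀ : ℝ} (hc : 0 < c) (hr₀ : 0 < r₀)
    (hΩ : MeasureDensity Ω c r₀) {w : EuclideanSpace ℝ (Fin N) → ℝ}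
    (hw : AEMeasurable w (volume.restrict Ω)) (hw0 : ∀ x, 0 ≤ w x) {b : ℝ} (hb : ∀ x, w x ≤ b) :
    (∫⁻ x in Ω, ENNReal.ofReal (w x ^ critExp N s)) ^ (2 / critExp N s) ≤
      ENNReal.ofReal (sobolevConst N s c r₀ (volume Ω).toReal) *
        ((∫⁻ z in Ω ×ˢ Ω, ENNReal.ofReal (gagliardoIntegrand s w w z)) +
          ∫⁻ x in Ω, ENNReal.ofReal (w x ^ 2)) := by
  have hprod : ∫⁻ z in Ω ×ˢ Ω, ENNReal.ofReal (gagliardoIntegrand s w w z) =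
      ∫⁻ x in Ω, ∫⁻ y in Ω, ENNReal.ofReal (gagliardoIntegrand s w w (x, y)) := by
    rw [Measure.volume_eq_prod, ← Measure.prod_restrict,
      lintegral_prod _ (aemeasurable_gagliardoIntegrand s hw hw).ennreal_ofReal]
  set q := critExp N s with hq
  have hq2 : 2 < q := two_lt_critExp hs hN
  have hNpos : (0 : ℝ) < N := by linarith
  have hfin : ∀ a : ℝ, 0 ≤ a → ∫⁻ x in Ω, ENNReal.ofReal (w x ^ a) ≠ ⊤ := by
    intro a ha
    have h1 : ∫⁻ x in Ω, ENNReal.ofReal (w x ^ a) ≤ ∫⁻ _ in Ω, ENNReal.ofReal (b ^ a) :=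
      lintegral_mono fun x => ENNReal.ofReal_le_ofReal (Real.rpow_le_rpow (hw0 x) (hb x) ha)
    rw [setLIntegral_const] at h1
    exact ne_top_of_le_ne_top (ENNReal.mul_ne_top ENNReal.ofReal_ne_top hΩfin) h1
  set I := ∫⁻ x in Ω, ENNReal.ofReal (w x ^ q) with hI
  have hItop : I ≠ ⊤ := hfin q (by linarith)
  have hJ : ∫⁻ x in Ω, ENNReal.ofReal (w x ^ 2) = ∫⁻ x in Ω, ENNReal.ofReal (w x ^ (2 : ℝ)) := by
    simp only [Real.rpow_two]
  rw [hJ]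
  set J := ∫⁻ x in Ω, ENNReal.ofReal (w x ^ (2 : ℝ)) with hJdef
  have hJtop : J ≠ ⊤ := hfin 2 (by norm_num)
  set G := ∫⁻ z in Ω ×ˢ Ω, ENNReal.ofReal (gagliardoIntegrand s w w z) with hG
  set V := (volume Ω).toReal with hV
  have hV0 : 0 ≤ V := ENNReal.toReal_nonneg
  have hslice : 0 < sliceConst N s c := by unfold sliceConst; positivity
  have hC : 0 < sobolevConst N s c r₀ V := by
    unfold sobolevConst
    have : 0 ≤ (2 * V) ^ (2 / critExp N s) * (8 / (c * r₀ ^ N)) := by positivity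
    linarith
  have h2q : 0 < 2 / q := by positivity
  by_cases hI0 : I = 0
  · rw [hI0, ENNReal.zero_rpow_of_pos h2q]; exact zero_le
  have hJ0 : J ≠ 0 := by
    intro h
    refine hI0 ?_
    rw [hJdef, lintegral_eq_zero_iff' (hw.pow_const _).ennreal_ofReal] at h
    rw [hI, lintegral_eq_zero_iff' (hw.pow_const _).ennreal_ofReal]
    filter_upwards [h] with x hx
    have h1 : w x ^ (2 : ℝ) ≤ 0 := ENNReal.ofReal_eq_zero.1 hx
    have h2 : w x = 0 := by
      rw [Real.rpow_two] at h1
      nlinarith [hw0 x]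
    simp [h2, Real.zero_rpow (show q ≠ 0 by linarith)]
  by_cases hGtop : G = ⊤
  · rw [hGtop, top_add, ENNReal.mul_top (by simpa using hC)]; exact le_top
  set S := I.toReal with hS
  set S₂ := J.toReal with hS₂
  set g := G.toReal with hg
  have hSpos : 0 < S := ENNReal.toReal_pos hI0 hItop
  have hS₂pos : 0 < S₂ := ENNReal.toReal_pos hJ0 hJtop
  have hg0 : 0 ≤ g := ENNReal.toReal_nonneg
  have hIS : I = ENNReal.ofReal S := (ENNReal.ofReal_toReal hItop).symm
  have hJS : J = ENNReal.ofReal S₂ := (ENNReal.ofReal_toReal hJtop).symm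
  have hGg : G = ENNReal.ofReal g := (ENNReal.ofReal_toReal hGtop).symm
  -- The threshold at which `hlarge` of the slice estimate becomes available; below it, `w ^ q ≤ T ^
  -- (q / 2)`.
  set T : ℝ := 8 / (c * r₀ ^ N) * S₂ with hT
  have hTpos : 0 < T := by positivity
  have hpt : ∀ x ∈ Ω, ENNReal.ofReal (w x ^ q) ≤ ENNReal.ofReal (T ^ (q / 2)) +
      ENNReal.ofReal (sliceConst N s c * S ^ (2 * s / N)) *
        ∫⁻ y in Ω, ENNReal.ofReal (gagliardoIntegrand s w w (x, y)) := by
    intro x hx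
    by_cases hxT : w x ^ 2 ≤ T
    · refine le_add_right (ENNReal.ofReal_le_ofReal ?_)
      calc w x ^ q = (w x ^ 2) ^ (q / 2) := by
            rw [← Real.rpow_two, ← Real.rpow_mul (hw0 x)]; congr 1; ring
        _ ≤ _ := Real.rpow_le_rpow (by positivity) hxT (by positivity)
    · have hxT : T < w x ^ 2 := not_le.1 hxT
      have hwx : 0 < w x := by
        refine (hw0 x).lt_of_ne fun h => ?_
        rw [← h] at hxT
        norm_num at hxT
        linarith
      refine le_add_left (rpow_critExp_le_slice hs hN hc hr₀ hΩ hw hSpos hS₂pos hIS.le hJS.le hx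
        hwx ?_)
      rw [hT, div_mul_eq_mul_div, div_lt_iff₀ (by positivity)] at hxT
      linarith
  have hint : I ≤ ENNReal.ofReal (T ^ (q / 2)) * volume Ω +
      ENNReal.ofReal (sliceConst N s c * S ^ (2 * s / N)) * G := by
    refine (setLIntegral_mono' hΩm hpt).trans (le_of_eq ?_)
    rw [lintegral_add_left measurable_const, setLIntegral_const,
      lintegral_const_mul' _ _ ENNReal.ofReal_ne_top, hprod]
  rw [← ENNReal.ofReal_toReal hΩfin, ← hV, hGg, hIS, ← ENNReal.ofReal_mul (by positivity),
    ← ENNReal.ofReal_mul (by positivity), ← ENNReal.ofReal_add (by positivity) (by positivity),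
    ENNReal.ofReal_le_ofReal_iff (by positivity)] at hint
  rw [hIS, hJS, hGg, ← ENNReal.ofReal_add hg0 hS₂pos.le, ← ENNReal.ofReal_mul hC.le,
    ENNReal.ofReal_rpow_of_pos hSpos]
  refine ENNReal.ofReal_le_ofReal ?_
  have hA0 : 0 ≤ (2 * V) ^ (2 / q) * (8 / (c * r₀ ^ N)) := by positivity
  have hexp : sobolevConst N s c r₀ V * (g + S₂) =
      (2 * V) ^ (2 / q) * (8 / (c * r₀ ^ N)) * g + (2 * V) ^ (2 / q) * (8 / (c * r₀ ^ N)) * S₂ +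
      2 * sliceConst N s c * g + 2 * sliceConst N s c * S₂ := by rw [sobolevConst]; ring
  have hp1 := mul_nonneg hA0 hg0
  have hp2 := mul_nonneg hA0 hS₂pos.le
  have hp3 := mul_nonneg hslice.le hg0
  have hp4 := mul_nonneg hslice.le hS₂pos.le
  rw [hexp]
  -- The larger of the two terms bounds `S / 2`. If it is the Gagliardo term, dividing by `S ^ (2s /
  -- N)` leaves `S ^ (2 / q)`, since `1 - 2s / N = 2 / q`.
  rcases le_total (T ^ (q / 2) * V) (sliceConst N s c * S ^ (2 * s / N) * g) with h | h
  · have h1 : S ≤ 2 * sliceConst N s c * g * S ^ (2 * s / N) := by linarith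
    have h2 : S ^ (2 / q) * S ^ (2 * s / N) = S := by
      rw [← Real.rpow_add hSpos, hq, ← one_sub_eq_two_div_critExp hs hN]; simp
    have h3 : S ^ (2 / q) ≤ 2 * sliceConst N s c * g :=
      le_of_mul_le_mul_right (h2.le.trans h1) (by positivity)
    linarith
  · have h1 : S ≤ 2 * V * T ^ (q / 2) := by linarith
    have h2 : S ^ (2 / q) ≤ (2 * V) ^ (2 / q) * T := by
      refine (Real.rpow_le_rpow hSpos.le h1 h2q.le).trans (le_of_eq ?_)
      rw [Real.mul_rpow (by positivity) (by positivity), ← Real.rpow_mul hTpos.le,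
        show q / 2 * (2 / q) = 1 by field_simp, Real.rpow_one]
    rw [hT, ← mul_assoc] at h2
    linarith

/-- The critical fractional Sobolev inequality on sets with the measure density property. -/
theorem lintegral_rpow_critExp_le {N : ℕ} {s : ℝ} (hs : 0 < s) (hN : 2 * s < N)
    {Ω : Set (EuclideanSpace ℝ (Fin N))} (hΩm : MeasurableSet Ω) (hΩfin : volume Ω ≠ ⊤)
    {c r₀ : ℝ} (hc : 0 < c) (hr₀ : 0 < r₀)
    (hΩ : MeasureDensity Ω c r₀) {w : EuclideanSpace ℝ (Fin N) → ℝ}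
    (hw : AEMeasurable w (volume.restrict Ω)) (hw0 : ∀ x, 0 ≤ w x) :
    (∫⁻ x in Ω, ENNReal.ofReal (w x ^ critExp N s)) ^ (2 / critExp N s) ≤
      ENNReal.ofReal (sobolevConst N s c r₀ (volume Ω).toReal) *
        ((∫⁻ z in Ω ×ˢ Ω, ENNReal.ofReal (gagliardoIntegrand s w w z)) +
          ∫⁻ x in Ω, ENNReal.ofReal (w x ^ 2)) := by
  have hq2 : 2 < critExp N s := two_lt_critExp hs hN
  set w' : ℕ → EuclideanSpace ℝ (Fin N) → ℝ := fun n x => min (w x) n with hw'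
  have hw'0 : ∀ n x, 0 ≤ w' n x := fun n x => le_min (hw0 x) n.cast_nonneg
  have hw'w : ∀ n x, w' n x ≤ w x := fun n x => min_le_left _ _
  have hmeas : ∀ n, AEMeasurable (w' n) (volume.restrict Ω) := fun n => hw.min aemeasurable_const
  have htend : Tendsto (fun n => ∫⁻ x in Ω, ENNReal.ofReal (w' n x ^ critExp N s)) atTop
      (𝓝 (∫⁻ x in Ω, ENNReal.ofReal (w x ^ critExp N s))) := by
    refine lintegral_tendsto_of_tendsto_of_monotone
      (fun n => ((hmeas n).pow_const _).ennreal_ofReal) ?_ ?_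
    · refine ae_of_all _ fun x m n hmn => ENNReal.ofReal_le_ofReal ?_
      exact Real.rpow_le_rpow (hw'0 m x) (min_le_min_left _ (by exact_mod_cast hmn)) (by linarith)
    · refine ae_of_all _ fun x => tendsto_const_nhds.congr' ?_
      obtain ⟨n₀, hn₀⟩ := exists_nat_ge (w x)
      filter_upwards [eventually_ge_atTop n₀] with n hn
      have : w' n x = w x := min_eq_left (hn₀.trans (by exact_mod_cast hn))
      rw [this]
  refine le_of_tendsto' ((ENNReal.continuous_rpow_const (y := 2 / critExp N s)).tendsto _ |>.comp
    htend) fun n => ?_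
  refine (lintegral_rpow_critExp_le_of_bounded hs hN hΩm hΩfin hc hr₀ hΩ (hmeas n) (hw'0 n)
    (fun x => min_le_right _ _)).trans ?_
  gcongr with z x
  · unfold gagliardoIntegrand
    have h1 : |w' n z.1 - w' n z.2| ≤ |w z.1 - w z.2| := by
      have := abs_min_sub_min_le_max (w z.1) n (w z.2) n
      simpa using this
    have h2 := sq_le_sq.2 h1
    gcongr ?_ / _
    nlinarith
  · exact hw'0 n x
  · exact hw'w n x

/-! ### Truncations and the energy form -/

theorem normConst_pos {N : ℕ} {s : ℝ} (hs0 : 0 < s) (hs1 : s < 1) : 0 < normConst N s := by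
  have h1 : 0 < Real.Gamma ((N : ℝ) / 2 + s) := Real.Gamma_pos_of_pos (by positivity)
  have h2 : 0 < Real.Gamma (1 - s) := Real.Gamma_pos_of_pos (by linarith)
  have := Real.pi_pos
  unfold normConst
  positivity

/-- The truncations of the real line which act on `H^s_ε(Ω)` by composition. -/
structure IsTruncation (φ : ℝ → ℝ) : Prop where
  measurable : Measurable φ
  map_zero : φ 0 = 0
  mono : Monotone φ
  sub_le : ∀ a b : ℝ, a ≤ b → φ b - φ a ≤ b - a

namespace IsTruncation

variable {φ : ℝ → ℝ}

theorem mul_self_sub_le (hφ : IsTruncation φ) (a b : ℝ) :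
    (φ a - φ b) * (φ a - φ b) ≤ (a - b) * (φ a - φ b) := by
  rcases le_total a b with h | h
  · have h1 := hφ.mono h
    have h2 := hφ.sub_le _ _ h
    nlinarith
  · have h1 := hφ.mono h
    have h2 := hφ.sub_le _ _ h
    nlinarith

theorem sub_mul_sub_le (hφ : IsTruncation φ) (a b : ℝ) :
    (a - b) * (φ a - φ b) ≤ (a - b) * (a - b) := by
  rcases le_total a b with h | h
  · have h2 := hφ.sub_le _ _ h
    nlinarith
  · have h2 := hφ.sub_le _ _ h
    nlinarith

theorem sq_le_mul (hφ : IsTruncation φ) (a : ℝ) : φ a ^ 2 ≤ a * φ a := by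
  simpa [hφ.map_zero, sq] using hφ.mul_self_sub_le a 0

theorem mul_le_sq (hφ : IsTruncation φ) (a : ℝ) : a * φ a ≤ a ^ 2 := by
  simpa [hφ.map_zero, sq] using hφ.sub_mul_sub_le a 0

theorem max_sub {k : ℝ} (hk : 0 ≤ k) : IsTruncation fun t => max (t - k) 0 where
  measurable := (measurable_id.sub_const k).max measurable_const
  map_zero := max_eq_right (by linarith)
  mono a b h := max_le_max_right _ (by linarith)
  sub_le a b h := by
    rcases max_cases (b - k) 0 with h1 | h1 <;> rcases max_cases (a - k) 0 with h2 | h2 <;>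
      simp only [h1.1, h2.1] <;> linarith [h1.2, h2.2]

theorem min_zero : IsTruncation fun t => min t 0 where
  measurable := measurable_id.min measurable_const
  map_zero := min_self 0
  mono a b h := min_le_min_right _ h
  sub_le a b h := by
    rcases min_cases b 0 with h1 | h1 <;> rcases min_cases a 0 with h2 | h2 <;>
      simp only [h1.1, h2.1] <;> linarith [h1.2, h2.2]

variable {N : ℕ} {s : ℝ} {u : EuclideanSpace ℝ (Fin N) → ℝ}

theorem gagliardoIntegrand_comp_self_le (hφ : IsTruncation φ)
    (z : EuclideanSpace ℝ (Fin N) × EuclideanSpace ℝ (Fin N)) :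
    gagliardoIntegrand s (φ ∘ u) (φ ∘ u) z ≤ gagliardoIntegrand s u (φ ∘ u) z :=
  div_le_div_of_nonneg_right (hφ.mul_self_sub_le _ _) (by positivity)

theorem gagliardoIntegrand_comp_le (hφ : IsTruncation φ)
    (z : EuclideanSpace ℝ (Fin N) × EuclideanSpace ℝ (Fin N)) :
    gagliardoIntegrand s u (φ ∘ u) z ≤ gagliardoIntegrand s u u z :=
  div_le_div_of_nonneg_right (hφ.sub_mul_sub_le _ _) (by positivity)

theorem memHs_comp (hφ : IsTruncation φ) {ε : ℝ} {Ω : Set (EuclideanSpace ℝ (Fin N))}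
    (hu : MemHs s ε Ω u) : MemHs s ε Ω (φ ∘ u) := by
  refine ⟨hφ.measurable.comp_aemeasurable hu.aemeasurable, lt_of_le_of_lt ?_ hu.energy_lt_top⟩
  unfold energyNormSq
  refine add_le_add (mul_le_mul_right ?_ _) ?_
  · exact lintegral_mono fun z => ENNReal.ofReal_le_ofReal
      ((hφ.gagliardoIntegrand_comp_self_le z).trans (hφ.gagliardoIntegrand_comp_le z))
  · exact lintegral_mono fun x => ENNReal.ofReal_le_ofReal
      ((hφ.sq_le_mul _).trans (hφ.mul_le_sq _))

/-- Since `φ` is monotone and 1-Lipschitz, `(φ a - φ b)² ≤ (a - b)(φ a - φ b) ≤ (a - b)²`. The first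
inequality gives the estimate; the second gives the integrability needed to identify the Bochner
integrals in `energyForm` with lower integrals. -/
theorem energyNormSq_comp_le (hφ : IsTruncation φ) (hs0 : 0 < s) (hs1 : s < 1) {ε : ℝ}
    (hε : 0 < ε) {Ω : Set (EuclideanSpace ℝ (Fin N))} (hu : MemHs s ε Ω u) :
    energyNormSq s ε Ω (φ ∘ u) ≤ ENNReal.ofReal (energyForm s ε Ω u (φ ∘ u)) := by
  have hA : 0 < normConst N s * ε ^ (2 * s) / 2 := by
    have := normConst_pos (N := N) hs0 hs1
    positivity
  have hv := hφ.memHs_comp hu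
  have htop := hu.energy_lt_top
  unfold energyNormSq at htop
  obtain ⟨htop1, htop2⟩ := ENNReal.add_lt_top.1 htop
  have hgag : ∫⁻ z in interactionSet Ω, ENNReal.ofReal (gagliardoIntegrand s u u z) < ⊤ := by
    by_contra h
    rw [not_lt, top_le_iff] at h
    rw [h, ENNReal.mul_top (by simpa using hA)] at htop1
    exact lt_irrefl _ htop1
  have hint1 : Integrable (gagliardoIntegrand s u (φ ∘ u))
      (volume.restrict (interactionSet Ω)) := by
    have hm1 : AEMeasurable (gagliardoIntegrand s u u) (volume.restrict (interactionSet Ω)) :=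
      (aemeasurable_gagliardoIntegrand s hu.aemeasurable hu.aemeasurable).restrict
    have hm2 : AEMeasurable (gagliardoIntegrand s u (φ ∘ u))
        (volume.restrict (interactionSet Ω)) :=
      (aemeasurable_gagliardoIntegrand s hu.aemeasurable hv.aemeasurable).restrict
    have hi : Integrable (gagliardoIntegrand s u u) (volume.restrict (interactionSet Ω)) :=
      (lintegral_ofReal_ne_top_iff_integrable hm1.aestronglyMeasurable
        (ae_of_all _ (gagliardoIntegrand_self_nonneg s u))).1 hgag.ne
    refine hi.mono' hm2.aestronglyMeasurable (ae_of_all _ fun z => ?_)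
    rw [Real.norm_of_nonneg ((gagliardoIntegrand_self_nonneg s _ z).trans
      (hφ.gagliardoIntegrand_comp_self_le z))]
    exact hφ.gagliardoIntegrand_comp_le z
  have hint2 : Integrable (fun x => u x * (φ ∘ u) x) (volume.restrict Ω) := by
    have hi : Integrable (fun x => u x ^ 2) (volume.restrict Ω) :=
      (lintegral_ofReal_ne_top_iff_integrable
        (hu.aemeasurable.restrict.pow_const 2).aestronglyMeasurable
        (ae_of_all _ fun x => sq_nonneg (u x))).1 htop2.ne
    refine hi.mono' (hu.aemeasurable.mul hv.aemeasurable).restrict.aestronglyMeasurable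
      (ae_of_all _ fun x => ?_)
    rw [Real.norm_of_nonneg (show 0 ≤ u x * (φ ∘ u) x from (sq_nonneg _).trans (hφ.sq_le_mul _))]
    exact hφ.mul_le_sq _
  have hn1 : ∀ z, 0 ≤ gagliardoIntegrand s u (φ ∘ u) z := fun z =>
    (gagliardoIntegrand_self_nonneg s _ z).trans (hφ.gagliardoIntegrand_comp_self_le z)
  have hn2 : ∀ x, 0 ≤ u x * (φ ∘ u) x := fun x => (sq_nonneg _).trans (hφ.sq_le_mul _)
  unfold energyNormSq energyForm
  rw [ENNReal.ofReal_add (mul_nonneg hA.le (integral_nonneg hn1)) (integral_nonneg hn2),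
    ENNReal.ofReal_mul hA.le, ofReal_integral_eq_lintegral_ofReal hint1 (ae_of_all _ hn1),
    ofReal_integral_eq_lintegral_ofReal hint2 (ae_of_all _ hn2)]
  refine add_le_add (mul_le_mul_right ?_ _) ?_
  · exact lintegral_mono fun z => ENNReal.ofReal_le_ofReal (hφ.gagliardoIntegrand_comp_self_le z)
  · exact lintegral_mono fun x => ENNReal.ofReal_le_ofReal (hφ.sq_le_mul _)

end IsTruncation

/-- The Sobolev inequality for the norm of `H^s_ε(Ω)`. -/
theorem IsSmoothBoundedDomain.exists_sobolev {N : ℕ} {s : ℝ} (hs0 : 0 < s) (hs1 : s < 1)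
    (hN : 2 * s < N) {Ω : Set (EuclideanSpace ℝ (Fin N))} (hΩ : IsSmoothBoundedDomain Ω)
    {ε : ℝ} (hε : 0 < ε) :
    ∃ C : ℝ, 0 < C ∧ ∀ w : EuclideanSpace ℝ (Fin N) → ℝ, AEMeasurable w → (∀ x, 0 ≤ w x) →
      (∫⁻ x in Ω, ENNReal.ofReal (w x ^ critExp N s)) ^ (2 / critExp N s) ≤
        ENNReal.ofReal C * energyNormSq s ε Ω w := by
  obtain ⟨c, hc, r₀, hr₀, hd⟩ := hΩ.exists_measureDensity
  have hfin : volume Ω ≠ ⊤ := hΩ.isBounded.measure_lt_top.ne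
  set A := normConst N s * ε ^ (2 * s) / 2 with hA
  have hApos : 0 < A := by
    have := normConst_pos (N := N) hs0 hs1
    positivity
  set D := sobolevConst N s c r₀ (volume Ω).toReal with hD
  have hD0 : 0 ≤ D := by
    have : 0 ≤ (volume Ω).toReal := ENNReal.toReal_nonneg
    rw [hD]; unfold sobolevConst sliceConst; positivity
  -- `D / A` compensates the weight `A` of the Gagliardo term, `D` covers the `L²` term, and `1`
  -- ensures positivity.
  refine ⟨D / A + D + 1, by positivity, fun w hw hw0 => ?_⟩
  refine (lintegral_rpow_critExp_le hs0 hN hΩ.isOpen.measurableSet hfin hc hr₀ hd hw.restrict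
    hw0).trans ?_
  rw [energyNormSq, ← hA, mul_add, mul_add, ← mul_assoc,
    ← ENNReal.ofReal_mul (by positivity)]
  refine add_le_add (mul_le_mul' ?_ ?_) (mul_le_mul' ?_ le_rfl)
  · refine ENNReal.ofReal_le_ofReal ?_
    have : (D / A + D + 1) * A = D + D * A + A := by field_simp
    rw [this]
    have := mul_nonneg hD0 hApos.le
    linarith
  · exact lintegral_mono_set fun z hz h => h.1 hz.1
  · have : 0 ≤ D / A := by positivity
    exact ENNReal.ofReal_le_ofReal (by linarith)

/-! ### De Giorgi iteration -/

/-- A nonlinear recursion forcing convergence to zero once the parameter `K` is large. -/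
theorem exists_forall_tendsto_zero_of_recursion {p q B D M : ℝ} (hq : 2 < q) (hpq : p < q)
    (hB : 1 < B) (hM : 0 < M) :
    ∀ᶠ K : ℝ in atTop, ∀ y : ℕ → ℝ, (∀ j, 0 ≤ y j) → y 0 ≤ M →
      (∀ j, y (j + 1) ^ (2 / q) ≤ D * K ^ (p - q) * B ^ j * y j) → Tendsto y atTop (𝓝 0) := by
  have h2q : 0 < 2 / q := by positivity
  have h2q1 : 2 / q < 1 := by rw [div_lt_one (by linarith)]; exact hq
  -- Chosen so that `B * θ = θ ^ (2 / q)`, which makes the geometric bound `M * θ ^ j` reproduce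
  -- itself under the recursion.
  set θ : ℝ := B ^ (-(1 / (1 - 2 / q))) with hθ
  have hθ0 : 0 < θ := by positivity
  have hθ1 : θ < 1 := Real.rpow_lt_one_of_one_lt_of_neg hB
    (neg_neg_of_pos (div_pos one_pos (by linarith)))
  have hBθ : B * θ = θ ^ (2 / q) := by
    have hB0 : 0 < B := by linarith
    rw [hθ, ← Real.rpow_mul hB0.le]
    nth_rewrite 1 [← Real.rpow_one B]
    rw [← Real.rpow_add hB0]
    congr 1
    have : 1 - 2 / q ≠ 0 := by linarith
    generalize 2 / q = e at this ⊢
    field_simp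
    ring
  have hlim : Tendsto (fun K : ℝ => D * K ^ (p - q) * M) atTop (𝓝 0) := by
    have h := tendsto_rpow_neg_atTop (y := q - p) (by linarith)
    simpa using (h.const_mul D).mul_const M
  have hpos : 0 < (M * θ) ^ (2 / q) := by positivity
  filter_upwards [hlim.eventually_le_const hpos, eventually_ge_atTop 0] with K hK hK0
  intro y hy0 hyM hy
  by_cases hD : D < 0
  · have hyz : ∀ j, y (j + 1) = 0 := by
      intro j
      have h1 : y (j + 1) ^ (2 / q) ≤ 0 := by
        refine (hy j).trans ?_
        have : 0 ≤ K ^ (p - q) * B ^ j * y j :=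
          mul_nonneg (mul_nonneg (Real.rpow_nonneg hK0 _) (by positivity)) (hy0 j)
        nlinarith
      by_contra hne
      have : 0 < y (j + 1) := (hy0 _).lt_of_ne' hne
      exact absurd (Real.rpow_pos_of_pos this (2 / q)) (not_lt.2 h1)
    exact (tendsto_add_atTop_iff_nat 1).1 (by simp [hyz])
  have hD : 0 ≤ D := not_lt.1 hD
  have key : ∀ j, y j ≤ M * θ ^ j := by
    intro j
    induction j with
    | zero => simpa using hyM
    | succ j ih =>
      refine (Real.rpow_le_rpow_iff (hy0 _) (by positivity) h2q).1 ?_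
      calc y (j + 1) ^ (2 / q) ≤ D * K ^ (p - q) * B ^ j * y j := hy j
        _ ≤ D * K ^ (p - q) * B ^ j * (M * θ ^ j) := by gcongr
        _ = D * K ^ (p - q) * M * (B * θ) ^ j := by rw [mul_pow]; ring
        _ ≤ (M * θ) ^ (2 / q) * (B * θ) ^ j := by gcongr
        _ = (M * θ) ^ (2 / q) * (θ ^ j) ^ (2 / q) := by
          rw [hBθ, ← Real.rpow_natCast, ← Real.rpow_natCast, ← Real.rpow_mul hθ0.le,
            ← Real.rpow_mul hθ0.le, mul_comm (2 / q)]
        _ = _ := by rw [← Real.mul_rpow (by positivity) (by positivity)]; congr 1; ring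
  refine squeeze_zero hy0 key ?_
  simpa using (tendsto_pow_atTop_nhds_zero_of_lt_one hθ0.le hθ1).const_mul M

theorem IsWeakSolution.energyNormSq_comp_le {N : ℕ} {s ε : ℝ} (hs0 : 0 < s) (hs1 : s < 1)
    (hε : 0 < ε) {Ω : Set (EuclideanSpace ℝ (Fin N))} {f : ℝ → ℝ}
    {u : EuclideanSpace ℝ (Fin N) → ℝ} (hu : IsWeakSolution s ε Ω f u) {φ : ℝ → ℝ}
    (hφ : IsTruncation φ) :
    energyNormSq s ε Ω (φ ∘ u) ≤ ENNReal.ofReal (∫ x in Ω, f (u x) * φ (u x)) := by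
  have h := hu.weak_eq _ (hφ.memHs_comp hu.memHs)
  have h2 := hφ.energyNormSq_comp_le hs0 hs1 hε hu.memHs
  rwa [sub_eq_zero.1 h] at h2

/-- The product `f(u) min(u, 0)` vanishes identically, so testing with `min u 0` shows that its
energy is zero. -/
theorem IsWeakSolution.ae_nonneg {N : ℕ} {s ε : ℝ} (hs0 : 0 < s) (hs1 : s < 1)
    (hε : 0 < ε) {Ω : Set (EuclideanSpace ℝ (Fin N))} {f : ℝ → ℝ}
    (hf : ∀ t : ℝ, t < 0 → f t = 0)
    {u : EuclideanSpace ℝ (Fin N) → ℝ} (hu : IsWeakSolution s ε Ω f u) :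
    ∀ᵐ x ∂(volume.restrict Ω), 0 ≤ u x := by
  have h := hu.energyNormSq_comp_le hs0 hs1 hε IsTruncation.min_zero
  have h0 : ∀ x, f (u x) * min (u x) 0 = 0 := by
    intro x
    rcases lt_or_ge (u x) 0 with hx | hx
    · rw [hf _ hx, zero_mul]
    · rw [min_eq_right hx, mul_zero]
  simp only [h0, integral_zero, ENNReal.ofReal_zero] at h
  have h1 : ∫⁻ x in Ω, ENNReal.ofReal (min (u x) 0 ^ 2) = 0 :=
    le_antisymm (le_add_self.trans h) zero_le
  rw [lintegral_eq_zero_iff'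
    ((hu.memHs.aemeasurable.restrict.min aemeasurable_const).pow_const 2).ennreal_ofReal] at h1
  filter_upwards [h1] with x hx
  have h2 : min (u x) 0 ^ 2 ≤ 0 := ENNReal.ofReal_eq_zero.1 hx
  have h3 : min (u x) 0 = 0 := by nlinarith [sq_nonneg (min (u x) 0)]
  exact min_eq_right_iff.1 h3

/-- The increasing truncation levels `K (1 - 2⁻ʲ)`. -/
noncomputable def level (K : ℝ) (j : ℕ) : ℝ := K * (1 - (1 / 2) ^ j)

theorem level_zero (K : ℝ) : level K 0 = 0 := by simp [level]

theorem level_nonneg {K : ℝ} (hK : 0 ≤ K) (j : ℕ) : 0 ≤ level K j :=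
  mul_nonneg hK (sub_nonneg.2 (pow_le_one₀ (by norm_num) (by norm_num)))

theorem level_le {K : ℝ} (hK : 0 ≤ K) (j : ℕ) : level K j ≤ K := by
  have : 0 ≤ K * (1 / 2) ^ j := by positivity
  rw [level, mul_sub, mul_one]; linarith

/-- Where the left side is nonzero, `v = t - level K j` is at least the gap `δ = K 2⁻⁽ʲ⁺¹⁾`. Hence
`t ≤ 2 ^ (j + 2) * v` and `v ^ (p - q) ≤ δ ^ (p - q)`, which trades the power `p` for `q`. There
also `t ≥ level K 1 = K / 2`, so growth of `f` is needed only beyond `K / 2`. -/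
theorem mul_truncation_le {f : ℝ → ℝ} {p q K : ℝ} (hp : 2 < p) (hpq : p < q) (hK : 0 < K)
    (hf : ∀ t : ℝ, K / 2 ≤ t → f t ≤ t ^ (p - 1)) (j : ℕ) (t : ℝ) :
    f t * max (t - level K (j + 1)) 0 ≤
      (2 ^ (q - 1)) ^ 2 * K ^ (p - q) * (2 ^ (q - 1)) ^ j * max (t - level K j) 0 ^ q := by
  have hgap : level K (j + 1) - level K j = K * (1 / 2) ^ (j + 1) := by
    rw [level, level, pow_succ]; ring
  rcases le_total t (level K (j + 1)) with h | h
  · rw [max_eq_right (sub_nonpos.2 h), mul_zero]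
    have : 0 ≤ max (t - level K j) 0 ^ q := Real.rpow_nonneg (le_max_right _ _) _
    positivity
  set δ : ℝ := K * (1 / 2) ^ (j + 1) with hδ
  have hδ0 : 0 < δ := by positivity
  rw [max_eq_left (sub_nonneg.2 h), max_eq_left (by linarith)]
  set v := t - level K j with hv
  have hvδ : δ ≤ v := by linarith
  have hv0 : 0 < v := hδ0.trans_le hvδ
  have hKδ : K = δ * 2 ^ (j + 1) := by
    rw [hδ, mul_assoc, ← mul_pow]; norm_num
  have htK : K / 2 ≤ t := by
    have : (1 / 2 : ℝ) ^ (j + 1) ≤ 1 / 2 := by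
      rw [pow_succ]
      have : (1 / 2 : ℝ) ^ j ≤ 1 := pow_le_one₀ (by norm_num) (by norm_num)
      linarith
    have h2 : K / 2 ≤ level K (j + 1) := by rw [level]; nlinarith
    linarith
  have htv : t ≤ 2 ^ (j + 2) * v := by
    have h1 : t ≤ v + K := by have := level_le hK.le j; linarith
    have h2 : K ≤ 2 ^ (j + 1) * v := by rw [hKδ, mul_comm]; gcongr
    have h3 : v ≤ 2 ^ (j + 1) * v := le_mul_of_one_le_left hv0.le (one_le_pow₀ (by norm_num))
    rw [pow_succ]; linarith
  have ht0 : 0 < t := by linarith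
  have hvp : v ^ (p - 1) * v = v ^ (p - q) * v ^ q := by
    rw [← Real.rpow_add hv0]
    nth_rewrite 2 [← Real.rpow_one v]
    rw [← Real.rpow_add hv0]; congr 1; ring
  have hconst : ((2 : ℝ) ^ (j + 2)) ^ (p - 1) * ((1 / 2 : ℝ) ^ (j + 1)) ^ (p - q) ≤
      (2 ^ (q - 1)) ^ 2 * (2 ^ (q - 1)) ^ j := by
    rw [← pow_add, one_div, inv_pow, ← Real.rpow_natCast, ← Real.rpow_natCast 2 (j + 1),
      ← Real.rpow_natCast _ (2 + j), ← Real.rpow_neg (by norm_num), ← Real.rpow_mul (by norm_num),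
      ← Real.rpow_mul (by norm_num), ← Real.rpow_mul (by norm_num), ← Real.rpow_add (by norm_num)]
    refine Real.rpow_le_rpow_of_exponent_le (by norm_num) ?_
    push_cast
    nlinarith [(Nat.cast_nonneg j : (0 : ℝ) ≤ j)]
  have hvq : 0 ≤ v ^ q := by positivity
  calc f t * (t - level K (j + 1)) ≤ t ^ (p - 1) * v := by
        refine mul_le_mul (hf t htK) (by linarith) (by linarith) (by positivity)
    _ ≤ (2 ^ (j + 2) * v) ^ (p - 1) * v := by
        gcongr
        linarith
    _ = (2 ^ (j + 2)) ^ (p - 1) * v ^ (p - q) * v ^ q := by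
        rw [Real.mul_rpow (by positivity) hv0.le, mul_assoc, hvp, mul_assoc]
    _ ≤ (2 ^ (j + 2)) ^ (p - 1) * δ ^ (p - q) * v ^ q := by
        gcongr ?_ * ?_ * ?_
        exact Real.rpow_le_rpow_of_nonpos hδ0 hvδ (by linarith)
    _ = ((2 : ℝ) ^ (j + 2)) ^ (p - 1) * ((1 / 2 : ℝ) ^ (j + 1)) ^ (p - q) *
          (K ^ (p - q) * v ^ q) := by
        rw [hδ, Real.mul_rpow hK.le (by positivity)]; ring
    _ ≤ (2 ^ (q - 1)) ^ 2 * (2 ^ (q - 1)) ^ j * (K ^ (p - q) * v ^ q) := by gcongr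
    _ = _ := by ring

theorem IsWeakSolution.ae_le {N : ℕ} {s ε : ℝ} (hs0 : 0 < s) (hs1 : s < 1) (hN : 2 * s < N)
    (hε : 0 < ε) {Ω : Set (EuclideanSpace ℝ (Fin N))} (hΩ : IsSmoothBoundedDomain Ω) {f : ℝ → ℝ}
    (hf0 : ∀ t : ℝ, 0 < t → 0 < f t) {p : ℝ} (hp : 2 < p) (hpq : p < critExp N s)
    (hfp : ∀ᶠ t : ℝ in atTop, f t ≤ t ^ (p - 1))
    {u : EuclideanSpace ℝ (Fin N) → ℝ} (hu : IsWeakSolution s ε Ω f u) :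
    ∃ K : ℝ, ∀ᵐ x ∂(volume.restrict Ω), u x ≤ K := by
  obtain ⟨C, hC, hsob⟩ := hΩ.exists_sobolev hs0 hs1 hN hε
  set q := critExp N s with hq
  have hq2 : 2 < q := two_lt_critExp hs0 hN
  have h2q : 0 < 2 / q := by positivity
  obtain ⟨T, hT⟩ := eventually_atTop.1 hfp
  set Y : ℝ → ℝ≥0∞ := fun k => ∫⁻ x in Ω, ENNReal.ofReal (max (u x - k) 0 ^ q) with hY
  have hum := hu.memHs.aemeasurable
  have hmeas : ∀ k : ℝ, AEMeasurable fun x => max (u x - k) 0 := fun k =>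
    (hum.sub_const k).max aemeasurable_const
  have hsob' : ∀ k : ℝ, Y k ^ (2 / q) ≤
      ENNReal.ofReal C * energyNormSq s ε Ω (fun x => max (u x - k) 0) := fun k =>
    hsob _ (hmeas k) fun x => le_max_right _ _
  have hYtop : ∀ k : ℝ, 0 ≤ k → Y k ≠ ⊤ := by
    intro k hk htop
    have h1 := ((IsTruncation.max_sub hk).memHs_comp hu.memHs).energy_lt_top
    have h2 := (hsob' k).trans_lt (ENNReal.mul_lt_top ENNReal.ofReal_lt_top h1)
    rw [htop, ENNReal.top_rpow_of_pos h2q] at h2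
    exact lt_irrefl _ h2
  -- `M` is fixed by `Y 0` before `K` is chosen; the added `1` makes it positive. `K ≥ 2 * T` puts
  -- `K / 2` in the range of the growth bound.
  obtain ⟨K, hrec, hKT, hK1⟩ := ((exists_forall_tendsto_zero_of_recursion (p := p)
    (B := 2 ^ (q - 1)) (D := C * (2 ^ (q - 1)) ^ 2) (M := (Y 0).toReal + 1) hq2 hpq
    (Real.one_lt_rpow (by norm_num) (by linarith))
    (by have : 0 ≤ (Y 0).toReal := ENNReal.toReal_nonneg
        linarith)).and ((eventually_ge_atTop (2 * T)).and (eventually_ge_atTop 1))).exists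
  have hK0 : 0 < K := by linarith
  have hlev := level_nonneg hK0.le
  have hstep : ∀ j : ℕ, (Y (level K (j + 1))).toReal ^ (2 / q) ≤
      C * (2 ^ (q - 1)) ^ 2 * K ^ (p - q) * (2 ^ (q - 1)) ^ j * (Y (level K j)).toReal := by
    intro j
    set c : ℝ := (2 ^ (q - 1)) ^ 2 * K ^ (p - q) * (2 ^ (q - 1)) ^ j with hc
    have hc0 : 0 ≤ c := by positivity
    have hmq : AEMeasurable (fun x => max (u x - level K j) 0 ^ q) (volume.restrict Ω) :=
      ((hmeas _).pow_const q).restrict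
    have hnn : ∀ x, 0 ≤ max (u x - level K j) 0 ^ q := fun x =>
      Real.rpow_nonneg (le_max_right _ _) _
    have hint : Integrable (fun x => max (u x - level K j) 0 ^ q) (volume.restrict Ω) :=
      (lintegral_ofReal_ne_top_iff_integrable hmq.aestronglyMeasurable
        (ae_of_all _ hnn)).1 (hYtop _ (hlev j))
    have heq : ∫ x in Ω, max (u x - level K j) 0 ^ q = (Y (level K j)).toReal :=
      integral_eq_lintegral_of_nonneg_ae (ae_of_all _ hnn) hmq.aestronglyMeasurable
    have hle : ∫ x in Ω, f (u x) * max (u x - level K (j + 1)) 0 ≤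
        c * (Y (level K j)).toReal := by
      rw [← heq, ← integral_const_mul]
      refine integral_mono_of_nonneg (ae_of_all _ fun x => ?_) (hint.const_mul c)
        (ae_of_all _ fun x => mul_truncation_le hp hpq hK0
          (fun t ht => hT t (by linarith)) j (u x))
      -- The sign of `f 0` is not assumed: at equality the truncation vanishes, and above the level
      -- `u x > 0`.
      rcases le_total (u x) (level K (j + 1)) with h | h
      · simp [max_eq_right (sub_nonpos.2 h)]
      · rcases h.eq_or_lt with h | h
        · simp [h]
        · exact mul_nonneg (hf0 _ ((hlev _).trans_lt h)).le (le_max_right _ _)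
    have h1 := (hsob' (level K (j + 1))).trans (mul_le_mul_right
      ((hu.energyNormSq_comp_le hs0 hs1 hε (IsTruncation.max_sub (hlev (j + 1)))).trans
        (ENNReal.ofReal_le_ofReal hle)) _)
    rw [← ENNReal.ofReal_mul hC.le] at h1
    have h2 := ENNReal.toReal_mono ENNReal.ofReal_ne_top h1
    rw [← ENNReal.toReal_rpow, ENNReal.toReal_ofReal
      (mul_nonneg hC.le (mul_nonneg hc0 ENNReal.toReal_nonneg))] at h2
    refine h2.trans (le_of_eq ?_)
    rw [hc]; ring
  have hlim := hrec (fun j => (Y (level K j)).toReal) (fun j => ENNReal.toReal_nonneg)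
    (by simp [level_zero]) hstep
  -- `Y` is nonincreasing and every level is at most `K`, so `Y K` lies below the whole vanishing
  -- sequence.
  have hYK : (Y K).toReal ≤ 0 := by
    refine ge_of_tendsto' hlim fun j => ENNReal.toReal_mono (hYtop _ (hlev j)) ?_
    refine lintegral_mono fun x => ENNReal.ofReal_le_ofReal ?_
    refine Real.rpow_le_rpow (le_max_right _ _) (max_le_max_right _ ?_) (by linarith)
    linarith [level_le hK0.le j]
  have hYK0 : Y K = 0 := by
    rcases (ENNReal.toReal_eq_zero_iff _).1 (le_antisymm hYK ENNReal.toReal_nonneg) with h | h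
    · exact h
    · exact absurd h (hYtop K hK0.le)
  rw [hY] at hYK0
  refine ⟨K, ?_⟩
  rw [lintegral_eq_zero_iff' ((hmeas K).restrict.pow_const q).ennreal_ofReal] at hYK0
  filter_upwards [hYK0] with x hx
  by_contra! h
  have h1 : 0 < max (u x - K) 0 := lt_max_of_lt_left (by linarith)
  exact absurd (ENNReal.ofReal_eq_zero.1 hx) (not_le.2 (Real.rpow_pos_of_pos h1 q))

end FracNeumann

theorem theorem2 (N : ℕ) (s : ℝ) (hs0 : 0 < s) (hs1 : s < 1) (hN : 2 * s < (N : ℝ))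
    (Ω : Set (EuclideanSpace ℝ (Fin N))) (hΩ : FracNeumann.IsSmoothBoundedDomain Ω)
    (f : ℝ → ℝ) (hf : Continuous f)
    (hf1 : (∀ t : ℝ, t < 0 → f t = 0) ∧ ∀ t : ℝ, 0 < t → 0 < f t)
    (hf2 : Tendsto (fun t : ℝ => f t / t) (𝓝[>] 0) (𝓝 0) ∧
      ∃ p : ℝ, 2 < p ∧ p < 2 * (N : ℝ) / ((N : ℝ) - 2 * s) ∧
        Tendsto (fun t : ℝ => f t / t ^ (p - 1)) atTop (𝓝 0))
    (hf3 : Tendsto (fun t : ℝ => f t / t) atTop atTop) :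
    ∃ ε₀ : ℝ, 0 < ε₀ ∧ ∀ ε : ℝ, 0 < ε → ε < ε₀ →
      ∀ u : EuclideanSpace ℝ (Fin N) → ℝ, FracNeumann.IsWeakSolution s ε Ω f u →
        MemLp u ⊤ (volume.restrict Ω) := by
  obtain ⟨-, p, hp, hpq, hlim⟩ := hf2
  -- Any positive `ε₀` works, since the argument applies to every `ε > 0`.
  refine ⟨1, one_pos, fun ε hε _ u hu => ?_⟩
  have hfp : ∀ᶠ t : ℝ in atTop, f t ≤ t ^ (p - 1) := by
    filter_upwards [hlim.eventually_le_const one_pos, eventually_gt_atTop 0] with t ht ht0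
    rwa [div_le_one (by positivity)] at ht
  obtain ⟨K, hK⟩ := hu.ae_le hs0 hs1 hN hε hΩ hf1.2 hp hpq hfp
  refine memLp_top_of_bound hu.memHs.aemeasurable.restrict.aestronglyMeasurable K ?_
  filter_upwards [hK, hu.ae_nonneg hs0 hs1 hε hf1.1] with x hx hx0
  rwa [Real.norm_of_nonneg hx0]
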